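/- Let $d\ge 1$ and $r>0$ be fixed. For each $m\ge 1$ let $a_1,\dots,a_m$ be independent standard normal random vectors in $\mathbb{R}^d$, let $h=h(m,r)=\sqrt{2r\log m}$, and for $x,y\in\mathbb{R}^d$ define the score \[ S(x,y)=\frac1m\sum_{i=1}^m \mathbf 1_{[\langle a_i,x\rangle\ge h]}\,\mathbf 1_{[\langle a_i,y\rangle\ge h]} . \] Fix $x,y$ in the Euclidean unit sphere $\mathbb{S}^{d-1}$ with $\langle x,y\rangle=\lambda<1$, and let $\mu=\mu(\lambda)$ and $\sigma^2=\sigma^2(\lambda)$, with $\sigma\ge 0$, be the expectation and the variance of $\mathbf 1_{[\langle a_i,x\rangle\ge h]}\mathbf 1_{[\langle a_i,y\rangle\ge h]}$; for fixed $m$ and $r$, these depend on $x,y\in\mathbb{S}^{d-1}$ only through $\lambda$. Case 1. If $\lambda<2r-1$, then $P(S(x,y)\ne 0)\le m\,\mu(\lambda)$ for every $m$, and $m\,\mu(\lambda)\to 0$ as $m\to\infty$. Case 2. If $\lambda>2r-1$, then the normalized score $\sqrt m\,(S(x,y)-\mu)/\sigma$ converges in distribution to a standard normal random variable as $m\to\infty$.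 -/

import Mathlib

open MeasureTheory ProbabilityTheory Filter Topology

noncomputable section

namespace GaussianScore

variable {d : ℕ}

/-- The threshold `h = √(2 r log m)`. -/
def threshold (r : ℝ) (m : ℕ) : ℝ :=
  Real.sqrt (2 * r * Real.log m)

/-- The coordinate of the hash of `x` that is given by the vector `a`: the indicator of the event
`⟨a, x⟩ ≥ h`, as a function of `a`. -/
def bit (h : ℝ) (x : EuclideanSpace ℝ (Fin d)) : EuclideanSpace ℝ (Fin d) → ℝ :=
  Set.indicator {a | inner ℝ a x ≥ h} 1

/-- The product of the two indicators of `⟨a, x⟩ ≥ h` and `⟨a, y⟩ ≥ h`, as a function of `a`. -/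
def hit (h : ℝ) (x y : EuclideanSpace ℝ (Fin d)) (a : EuclideanSpace ℝ (Fin d)) : ℝ :=
  bit h x a * bit h y a

/-- The score `S(x, y)` computed from the `m` vectors `a 0, …, a (m - 1)`. -/
def score {m : ℕ} (h : ℝ) (a : Fin m → EuclideanSpace ℝ (Fin d))
    (x y : EuclideanSpace ℝ (Fin d)) : ℝ :=
  (1 / (m : ℝ)) * ∑ i, hit h x y (a i)

/-- The expectation `μ` of one summand of the score, for a standard normal vector. -/
def mean (h : ℝ) (x y : EuclideanSpace ℝ (Fin d)) : ℝ :=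
  ∫ a, hit h x y a ∂(stdGaussian (EuclideanSpace ℝ (Fin d)))

/-- The variance `σ²` of one summand of the score, for a standard normal vector. -/
def sigmaSq (h : ℝ) (x y : EuclideanSpace ℝ (Fin d)) : ℝ :=
  variance (hit h x y) (stdGaussian (EuclideanSpace ℝ (Fin d)))

/-- The normalized score `√m (S(x, y) - μ) / σ`. -/
def normalizedScore {m : ℕ} (h : ℝ) (a : Fin m → EuclideanSpace ℝ (Fin d))
    (x y : EuclideanSpace ℝ (Fin d)) : ℝ :=
  Real.sqrt m * (score h a x y - mean h x y) / Real.sqrt (sigmaSq h x y)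

end GaussianScore

end

/-!
Write `p` for the mean of one summand, the Gaussian probability that both `⟨a, x⟩ ≥ h` and
`⟨a, y⟩ ≥ h`. Since `h² = 2 r log m`, for `λ > -1` the order of `p` is `m ^ (-2r / (1 + λ))` up to
factors `exp (O(√(log m)))`, and everything depends on whether `m * p` tends to `0` or to `∞`.

*Upper bound.* The inequalities give `⟨a, x + y⟩ ≥ 2h`, where `⟨a, x + y⟩` is a centered Gaussian
of variance `2 (1 + λ)`, and a Chernoff bound (`mean_le_exp_add`) makes `m * p → 0` if `λ < 2r - 1`.
The score is nonzero only if some summand is, so a union bound finishes this case.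

*Lower bound.* As `x` and `y` have the same norm, `⟨a, x + y⟩` and `⟨a, x - y⟩` are independent.
The inequalities hold as soon as the first lies in `[2h + 1, 2h + 2]` and the second in `[0, 1]`;
bounding the densities from below there (`pdf_mul_pdf_le_mean`) gives `m * p → ∞` if `λ > 2r - 1`.

*Normal limit.* The law of the summands changes with `m`, so the central limit theorem for one
sequence does not apply. The summands are uniformly bounded and `m * σ² → ∞`, because
`σ² = p (1 - p)` and `p → 0`; under these two conditions the second-order expansion of the
characteristic function has an error `o(1 / m)`, and the normal limit follows from Lévy's theorem
(`tendstoInDistribution_of_bounded_iid_rows`).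

That `p` and `σ²` depend on `x` and `y` only through `λ` holds because the joint characteristic
function of `⟨a, x⟩` and `⟨a, y⟩` does.
-/

/-! ### A central limit theorem for bounded arrays with identically distributed rows -/

/-- The third moment that controls the error of the second-order expansion is at most `C` times the
second moment, so that the bound keeps the variance as a factor; this makes it uniform in arrays
whose variances tend to `0`. -/
theorem norm_charFun_sub_quadratic_le {ν : Measure ℝ} [IsProbabilityMeasure ν] {C : ℝ}
    (hC : ∀ᵐ z ∂ν, |z| ≤ C) (hmean : ∫ z, z ∂ν = 0) {s : ℝ} (hs : |s| * C ≤ 1) :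
    ‖charFun ν s - (1 - s ^ 2 * (∫ z, z ^ 2 ∂ν) / 2 : ℝ)‖ ≤ |s| ^ 3 * C * ∫ z, z ^ 2 ∂ν := by
  have hint (k : ℕ) : Integrable (fun z : ℝ => z ^ k) ν := by
    refine .of_bound (C := C ^ k) (by fun_prop) ?_
    filter_upwards [hC] with z hz
    rw [norm_pow]
    exact pow_le_pow_left₀ (norm_nonneg _) hz k
  have hint1 : Integrable (fun z : ℝ => z) ν := by simpa using hint 1
  have hexp : Integrable (fun z : ℝ => Complex.exp (s * z * Complex.I)) ν := by
    refine .of_bound (C := 1) (by fun_prop) (ae_of_all _ fun z => ?_)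
    rw [← Complex.ofReal_mul, Complex.norm_exp_ofReal_mul_I]
  have hquad : Integrable
      (fun z : ℝ => ((1 - s ^ 2 * z ^ 2 / 2 : ℝ) : ℂ) + ((s * z : ℝ) : ℂ) * Complex.I) ν := by
    refine (Integrable.ofReal ?_).add ((hint1.const_mul s).ofReal.mul_const _)
    exact (integrable_const _).sub (((hint 2).const_mul _).div_const _)
  have hval : ∫ z, (((1 - s ^ 2 * z ^ 2 / 2 : ℝ) : ℂ) + ((s * z : ℝ) : ℂ) * Complex.I) ∂ν
      = (1 - s ^ 2 * (∫ z, z ^ 2 ∂ν) / 2 : ℝ) := by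
    rw [integral_add, integral_mul_const, integral_complex_ofReal, integral_complex_ofReal,
      integral_const_mul, hmean, integral_sub (integrable_const _)
        (((hint 2).const_mul _).div_const _), integral_div, integral_const_mul]
    · simp
    · refine Integrable.ofReal ?_
      exact (integrable_const _).sub (((hint 2).const_mul _).div_const _)
    · exact (hint1.const_mul s).ofReal.mul_const _
  rw [charFun_apply_real, ← hval, ← integral_sub hexp hquad, ← integral_const_mul]
  refine norm_integral_le_of_norm_le ((hint 2).const_mul _) ?_
  filter_upwards [hC] with z hz
  -- The quadratic is the second-order Taylor polynomial of `exp` at `0`, evaluated at `w = i s z`.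
  set w : ℂ := s * z * Complex.I with hw
  have hnorm : ‖w‖ = |s| * |z| := by simp [hw]
  have hle : ‖w‖ ≤ 1 := by
    rw [hnorm]
    exact (mul_le_mul_of_nonneg_left hz (abs_nonneg s)).trans hs
  have hsum : ((1 - s ^ 2 * z ^ 2 / 2 : ℝ) : ℂ) + ((s * z : ℝ) : ℂ) * Complex.I =
      ∑ k ∈ Finset.range 3, w ^ k / (k.factorial : ℂ) := by
    simp only [Finset.sum_range_succ, hw, mul_pow, Complex.I_sq]
    simp [Nat.factorial]
    ring
  rw [hsum]
  calc _ ≤ ‖w‖ ^ 3 * ((Nat.succ 3 : ℝ) * ((Nat.factorial 3 : ℝ) * (3 : ℕ))⁻¹) :=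
        Complex.exp_bound hle (by norm_num)
    _ ≤ ‖w‖ ^ 3 * 1 := by
        gcongr
        norm_num [Nat.factorial]
    _ = |s| ^ 3 * |z| * z ^ 2 := by
        rw [hnorm, ← sq_abs z]
        ring
    _ ≤ |s| ^ 3 * C * z ^ 2 := by gcongr

theorem tendsto_charFun_pow_of_bounded {ν : ℕ → Measure ℝ} [∀ m, IsProbabilityMeasure (ν m)]
    {C : ℝ} (hC : ∀ m, ∀ᵐ z ∂ν m, |z| ≤ C) (hmean : ∀ m, ∫ z, z ∂ν m = 0)
    (hvar : Tendsto (fun m : ℕ => m * ∫ z, z ^ 2 ∂ν m) atTop atTop) (t : ℝ) :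
    Tendsto (fun m : ℕ => charFun (ν m) ((√(m * ∫ z, z ^ 2 ∂ν m))⁻¹ * t) ^ m) atTop
      (𝓝 (Complex.exp (-t ^ 2 / 2))) := by
  set s : ℕ → ℝ := fun m => (√(m * ∫ z, z ^ 2 ∂ν m))⁻¹ * t with hs
  have hs0 : Tendsto s atTop (𝓝 0) := by
    rw [← zero_mul t]
    exact (tendsto_inv_atTop_zero.comp (Real.tendsto_sqrt_atTop.comp hvar)).mul_const t
  have habs : Tendsto (fun m => |s m|) atTop (𝓝 0) := by simpa using hs0.abs
  have hsC : Tendsto (fun m => |s m| * C) atTop (𝓝 0) := by simpa using habs.mul_const C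
  have hsCt : Tendsto (fun m => |s m| * C * t ^ 2) atTop (𝓝 0) := by simpa using hsC.mul_const _
  apply Complex.tendsto_pow_exp_of_isLittleO_sub_add_div
  refine Asymptotics.isLittleO_iff.2 fun c hc => ?_
  filter_upwards [hsC.eventually_le_const one_pos, hsCt.eventually_le_const hc,
    hvar.eventually_gt_atTop 0, eventually_gt_atTop 0] with m h1 h2 h3 h4
  have hm : (0 : ℝ) < m := by exact_mod_cast h4
  have hsq : s m ^ 2 * ∫ z, z ^ 2 ∂ν m = t ^ 2 / m := by
    have hv : (∫ z, z ^ 2 ∂ν m) ≠ 0 := fun h => by simp [h] at h3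
    rw [hs]
    simp only [mul_pow, inv_pow, Real.sq_sqrt h3.le]
    field_simp
  have key := norm_charFun_sub_quadratic_le (hC m) (hmean m) h1
  have hcast : ((1 - s m ^ 2 * (∫ z, z ^ 2 ∂ν m) / 2 : ℝ) : ℂ) = 1 + -(t : ℂ) ^ 2 / 2 / m := by
    rw [hsq]
    push_cast
    ring
  rw [hcast] at key
  refine key.trans ?_
  calc |s m| ^ 3 * C * ∫ z, z ^ 2 ∂ν m = |s m| * C * (s m ^ 2 * ∫ z, z ^ 2 ∂ν m) := by
        rw [← sq_abs (s m)]
        ring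
    _ = |s m| * C * t ^ 2 * (1 / m) := by
        rw [hsq]
        ring
    _ ≤ c * ‖(1 / m : ℂ)‖ := by
        simp only [norm_div, norm_one, Complex.norm_natCast]
        gcongr

/-- **Central limit theorem for triangular arrays** whose rows are independent, identically
distributed, centered and bounded by a common constant: the normalized row sums converge to the
standard normal distribution if their variances tend to infinity. -/
theorem tendstoInDistribution_of_bounded_iid_rows {Ω : ℕ → Type*} [∀ m, MeasurableSpace (Ω m)]
    {P : (m : ℕ) → Measure (Ω m)} [∀ m, IsProbabilityMeasure (P m)]
    {X : (m : ℕ) → Fin m → Ω m → ℝ} {ν : ℕ → Measure ℝ} [∀ m, IsProbabilityMeasure (ν m)]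
    (hlaw : ∀ m i, HasLaw (X m i) (ν m) (P m)) (hindep : ∀ m, iIndepFun (X m) (P m))
    {C : ℝ} (hC : ∀ m, ∀ᵐ z ∂ν m, |z| ≤ C) (hmean : ∀ m, ∫ z, z ∂ν m = 0)
    (hvar : Tendsto (fun m : ℕ => m * ∫ z, z ^ 2 ∂ν m) atTop atTop) :
    TendstoInDistribution (fun m ω => (√(m * ∫ z, z ^ 2 ∂ν m))⁻¹ * ∑ i, X m i ω)
      atTop (id : ℝ → ℝ) P (gaussianReal 0 1) where
  forall_aemeasurable m :=
    (Finset.aemeasurable_fun_sum _ fun i _ => (hlaw m i).aemeasurable).const_mul _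
  tendsto := by
    refine ProbabilityMeasure.tendsto_iff_tendsto_charFun.2 fun t => ?_
    have hrow (m : ℕ) : charFun ((P m).map
        fun ω => (√(m * ∫ z, z ^ 2 ∂ν m))⁻¹ * ∑ i, X m i ω) t =
          charFun (ν m) ((√(m * ∫ z, z ^ 2 ∂ν m))⁻¹ * t) ^ m := by
      rw [charFun_map_mul_comp (Finset.aemeasurable_fun_sum _ fun i _ => (hlaw m i).aemeasurable),
        (hindep m).charFun_map_fun_sum_eq_prod fun i => (hlaw m i).aemeasurable]
      simp [fun i => (hlaw m i).map_eq]
    have hlim : charFun ((gaussianReal 0 1).map id) t = Complex.exp (-t ^ 2 / 2) := by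
      simp [charFun_gaussianReal, neg_div]
    simp only [ProbabilityMeasure.coe_mk, hrow, hlim]
    exact tendsto_charFun_pow_of_bounded hC hmean hvar t

/-! ### One- and two-dimensional marginals of the standard Gaussian measure -/

section Gaussian

variable {E : Type*} [NormedAddCommGroup E] [InnerProductSpace ℝ E] [FiniteDimensional ℝ E]
  [MeasurableSpace E] [BorelSpace E]

theorem hasLaw_inner_stdGaussian (v : E) :
    HasLaw (fun a : E => inner ℝ a v) (gaussianReal 0 (‖v‖₊ ^ 2)) (stdGaussian E) where
  aemeasurable := by fun_prop
  map_eq := by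
    have h : (fun a : E => inner ℝ a v) = innerSL ℝ v := by
      ext a
      simp [real_inner_comm]
    rw [h, IsGaussian.map_eq_gaussianReal, integral_strongDual_stdGaussian,
      variance_dual_stdGaussian, innerSL_apply_norm]
    congr 1
    ext
    simp

/-- The Chernoff bound for `⟨a, v⟩`, with the parameter `s` left free. -/
theorem measureReal_inner_ge_le (v : E) (t : ℝ) {s : ℝ} (hs : 0 ≤ s) :
    (stdGaussian E).real {a | t ≤ inner ℝ a v} ≤ Real.exp (-s * t + ‖v‖ ^ 2 * s ^ 2 / 2) := by
  have hmgf := mgf_gaussianReal (hasLaw_inner_stdGaussian v).map_eq s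
  refine (measure_ge_le_exp_mul_mgf t hs ?_).trans_eq ?_
  · refine Integrable.of_integral_ne_zero ?_
    change mgf _ _ s ≠ 0
    rw [hmgf]
    positivity
  · rw [hmgf, ← Real.exp_add]
    simp

/-- The density of a centered Gaussian decreases on `[t, t + 1]` for `t ≥ 0`. -/
theorem gaussianPDFReal_le_measureReal_Icc (v : NNReal) (hv : v ≠ 0) {t : ℝ} (ht : 0 ≤ t) :
    gaussianPDFReal 0 v (t + 1) ≤ (gaussianReal 0 v).real (Set.Icc t (t + 1)) := by
  rw [measureReal_def, gaussianReal_apply_eq_integral _ hv, ENNReal.toReal_ofReal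
    (setIntegral_nonneg measurableSet_Icc fun z _ => gaussianPDFReal_nonneg _ _ _)]
  have h := setIntegral_mono_on (μ := volume) (s := Set.Icc t (t + 1))
    (f := fun _ => gaussianPDFReal 0 v (t + 1)) (g := gaussianPDFReal 0 v)
    (by simp) (integrable_gaussianPDFReal 0 v).integrableOn measurableSet_Icc ?_
  · simpa using h
  · intro z hz
    have : 0 ≤ z := ht.trans hz.1
    simp only [gaussianPDFReal, sub_zero]
    gcongr
    exact hz.2

theorem indepFun_inner_stdGaussian {u v : E} (huv : inner ℝ u v = 0) :
    IndepFun (fun a : E => inner ℝ a u) (fun a : E => inner ℝ a v) (stdGaussian E) := by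
  refine HasGaussianLaw.indepFun_of_covariance_eq_zero ?_ ?_
  · have h : (fun a : E => ((inner ℝ a u : ℝ), (inner ℝ a v : ℝ))) =
        ((innerSL ℝ u).prod (innerSL ℝ v)) ∘ id := by
      ext a <;> simp [real_inner_comm]
    rw [h]
    exact IsGaussian.hasGaussianLaw_id.map _
  · simp_rw [real_inner_comm u, real_inner_comm v]
    rw [← covarianceBilin_apply_eq_cov, covarianceBilin_stdGaussian]
    · exact huv
    · exact IsGaussian.memLp_two_id

theorem charFunDual_map_inner_prod_stdGaussian (z w : E) (L : StrongDual ℝ (ℝ × ℝ)) :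
    charFunDual ((stdGaussian E).map (fun a => ((inner ℝ a z : ℝ), (inner ℝ a w : ℝ)))) L =
      Complex.exp (-((‖z‖ ^ 2 * L (1, 0) ^ 2 + 2 * L (1, 0) * L (0, 1) * inner ℝ z w +
        ‖w‖ ^ 2 * L (0, 1) ^ 2 : ℝ) : ℂ) / 2) := by
  have h : (fun a : E => ((inner ℝ a z : ℝ), (inner ℝ a w : ℝ))) =
      (innerSL ℝ z).prod (innerSL ℝ w) := by
    ext a <;> simp [real_inner_comm]
  have hL : L.comp ((innerSL ℝ z).prod (innerSL ℝ w)) =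
      innerSL ℝ (L (1, 0) • z + L (0, 1) • w) := by
    ext a
    have hp : ((inner ℝ z a : ℝ), (inner ℝ w a : ℝ)) =
        (inner ℝ z a : ℝ) • ((1 : ℝ), (0 : ℝ)) + (inner ℝ w a : ℝ) • ((0 : ℝ), (1 : ℝ)) := by
      simp
    simp only [ContinuousLinearMap.comp_apply, ContinuousLinearMap.prod_apply,
      innerSL_apply_apply]
    rw [hp, map_add, map_smul, map_smul, inner_add_left, inner_smul_left, inner_smul_left]
    simp [mul_comm]
  rw [h, charFunDual_map, hL, charFunDual_stdGaussian, innerSL_apply_norm,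
    ← Complex.ofReal_pow, norm_add_sq_real, norm_smul, norm_smul, mul_pow, mul_pow,
    inner_smul_left, inner_smul_right]
  simp
  ring_nf

/-- The joint law of `⟨a, x⟩` and `⟨a, y⟩` is determined by the Gram matrix of `x` and `y`. -/
theorem map_inner_prod_stdGaussian_eq {F : Type*} [NormedAddCommGroup F] [InnerProductSpace ℝ F]
    [FiniteDimensional ℝ F] [MeasurableSpace F] [BorelSpace F] {x y : E} {x' y' : F}
    (hx : ‖x‖ = ‖x'‖) (hy : ‖y‖ = ‖y'‖) (hxy : inner ℝ x y = inner ℝ x' y') :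
    (stdGaussian E).map (fun a => ((inner ℝ a x : ℝ), (inner ℝ a y : ℝ))) =
      (stdGaussian F).map (fun a => ((inner ℝ a x' : ℝ), (inner ℝ a y' : ℝ))) := by
  have : IsProbabilityMeasure ((stdGaussian E).map
      (fun a => ((inner ℝ a x : ℝ), (inner ℝ a y : ℝ)))) :=
    Measure.isProbabilityMeasure_map (by fun_prop)
  have : IsProbabilityMeasure ((stdGaussian F).map
      (fun a => ((inner ℝ a x' : ℝ), (inner ℝ a y' : ℝ)))) :=
    Measure.isProbabilityMeasure_map (by fun_prop)
  refine Measure.ext_of_charFunDual (funext fun L => ?_)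
  rw [charFunDual_map_inner_prod_stdGaussian, charFunDual_map_inner_prod_stdGaussian,
    hx, hy, hxy]

end Gaussian

/-! ### Size of the mean and of the variance of a summand of the score -/

namespace GaussianScore
variable {d : ℕ}

theorem threshold_nonneg (r : ℝ) (m : ℕ) : 0 ≤ threshold r m := Real.sqrt_nonneg _

theorem threshold_sq {r : ℝ} (hr : 0 < r) (m : ℕ) :
    threshold r m ^ 2 = 2 * r * Real.log m :=
  Real.sq_sqrt (mul_nonneg (by positivity) (Real.log_natCast_nonneg m))

theorem tendsto_threshold {r : ℝ} (hr : 0 < r) : Tendsto (threshold r) atTop atTop :=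
  Real.tendsto_sqrt_atTop.comp
    ((Real.tendsto_log_atTop.comp tendsto_natCast_atTop_atTop).const_mul_atTop (by positivity))

/-- The event that both bits are `1`, as a set of vectors `a`; `hit` is its indicator. -/
def hitSet (h : ℝ) (x y : EuclideanSpace ℝ (Fin d)) : Set (EuclideanSpace ℝ (Fin d)) :=
  {a | h ≤ inner ℝ a x ∧ h ≤ inner ℝ a y}

theorem measurableSet_hitSet (h : ℝ) (x y : EuclideanSpace ℝ (Fin d)) :
    MeasurableSet (hitSet h x y) :=
  (measurableSet_le measurable_const (by fun_prop : Measurable fun a => inner ℝ a x)).inter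
    (measurableSet_le measurable_const (by fun_prop : Measurable fun a => inner ℝ a y))

theorem hit_eq_indicator (h : ℝ) (x y : EuclideanSpace ℝ (Fin d)) :
    hit h x y = (hitSet h x y).indicator 1 := by
  classical
  ext a
  by_cases hx : h ≤ inner ℝ a x <;> by_cases hy : h ≤ inner ℝ a y <;>
    simp [hit, bit, hitSet, hx, hy]

theorem measurable_hit (h : ℝ) (x y : EuclideanSpace ℝ (Fin d)) : Measurable (hit h x y) := by
  rw [hit_eq_indicator]
  exact measurable_one.indicator (measurableSet_hitSet h x y)

theorem hit_mem_Icc (h : ℝ) (x y a : EuclideanSpace ℝ (Fin d)) :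
    hit h x y a ∈ Set.Icc (0 : ℝ) 1 := by
  classical
  rw [hit_eq_indicator, Set.indicator_apply]
  split_ifs <;> simp

theorem mean_eq_measureReal (h : ℝ) (x y : EuclideanSpace ℝ (Fin d)) :
    mean h x y = (stdGaussian (EuclideanSpace ℝ (Fin d))).real (hitSet h x y) := by
  rw [mean, hit_eq_indicator, integral_indicator_one (measurableSet_hitSet h x y)]

theorem mean_mem_Icc (h : ℝ) (x y : EuclideanSpace ℝ (Fin d)) :
    mean h x y ∈ Set.Icc (0 : ℝ) 1 := by
  rw [mean_eq_measureReal]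
  exact ⟨measureReal_nonneg, measureReal_le_one⟩

theorem sigmaSq_eq (h : ℝ) (x y : EuclideanSpace ℝ (Fin d)) :
    sigmaSq h x y = mean h x y * (1 - mean h x y) := by
  have hsq : hit h x y ^ 2 = hit h x y := by
    ext a
    by_cases ha : a ∈ hitSet h x y <;> simp [hit_eq_indicator, ha]
  have hLp : MemLp (hit h x y) 2 (stdGaussian (EuclideanSpace ℝ (Fin d))) := by
    refine .of_bound (measurable_hit h x y).aestronglyMeasurable 1 (ae_of_all _ fun a => ?_)
    rw [Real.norm_of_nonneg (hit_mem_Icc h x y a).1]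
    exact (hit_mem_Icc h x y a).2
  rw [sigmaSq, variance_eq_sub hLp, hsq, ← mean]
  ring

theorem mean_eq_of_inner_eq {h : ℝ} {x y x' y' : EuclideanSpace ℝ (Fin d)} (hx : ‖x‖ = ‖x'‖)
    (hy : ‖y‖ = ‖y'‖) (hxy : inner ℝ x y = inner ℝ x' y') :
    mean h x y = mean h x' y' := by
  have hmap (z w : EuclideanSpace ℝ (Fin d)) : mean h z w =
      ((stdGaussian (EuclideanSpace ℝ (Fin d))).map
        (fun a => ((inner ℝ a z : ℝ), (inner ℝ a w : ℝ)))).real (Set.Ici h ×ˢ Set.Ici h) := by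
    rw [mean_eq_measureReal, map_measureReal_apply (by fun_prop)
      (measurableSet_Ici.prod measurableSet_Ici)]
    rfl
  rw [hmap, hmap, map_inner_prod_stdGaussian_eq hx hy hxy]

/-- A bound that ignores `y`; it serves only to show that the mean tends to `0`. -/
theorem mean_le_exp_left (h : ℝ) {x : EuclideanSpace ℝ (Fin d)} (hx : ‖x‖ = 1)
    (y : EuclideanSpace ℝ (Fin d)) : mean h x y ≤ Real.exp (-h + 1 / 2) := by
  rw [mean_eq_measureReal]
  refine (measureReal_mono (s₂ := {a | h ≤ inner ℝ a x}) fun a ha => ha.1).trans ?_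
  simpa [hx] using measureReal_inner_ge_le x h zero_le_one

theorem norm_add_sq_eq {x y : EuclideanSpace ℝ (Fin d)} (hx : ‖x‖ = 1) (hy : ‖y‖ = 1) :
    ‖x + y‖ ^ 2 = 2 * (1 + inner ℝ x y) := by
  rw [norm_add_sq_real, hx, hy]
  ring

/-- The Chernoff bound for `⟨a, x + y⟩ ≥ 2 h`. -/
theorem mean_le_exp_add (h : ℝ) {x y : EuclideanSpace ℝ (Fin d)} (hx : ‖x‖ = 1) (hy : ‖y‖ = 1)
    {s : ℝ} (hs : 0 ≤ s) :
    mean h x y ≤ Real.exp (-2 * s * h + (1 + inner ℝ x y) * s ^ 2) := by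
  rw [mean_eq_measureReal]
  refine (measureReal_mono (s₂ := {a | 2 * h ≤ inner ℝ a (x + y)}) fun a ha => ?_).trans
    ((measureReal_inner_ge_le (x + y) (2 * h) hs).trans_eq ?_)
  · have h1 := ha.1
    have h2 := ha.2
    simp only [Set.mem_ofPred_eq, inner_add_right]
    linarith
  · rw [norm_add_sq_eq hx hy]
    congr 1
    ring

theorem tendsto_mean_mul_nhds_zero {x y : EuclideanSpace ℝ (Fin d)} (hx : ‖x‖ = 1) (hy : ‖y‖ = 1)
    {r : ℝ} (hr : 0 < r) (hxy : inner ℝ x y < 2 * r - 1) :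
    Tendsto (fun m : ℕ => mean (threshold r m) x y * m) atTop (𝓝 0) := by
  have hc : (1 + inner ℝ x y) / (2 * r) - 1 < 0 := by
    rw [sub_neg, div_lt_one (by positivity)]
    linarith
  have hlim : Tendsto (fun m : ℕ => Real.exp (((1 + inner ℝ x y) / (2 * r) - 1) * Real.log m))
      atTop (𝓝 0) :=
    Real.tendsto_exp_atBot.comp
      ((Real.tendsto_log_atTop.comp tendsto_natCast_atTop_atTop).const_mul_atTop_of_neg hc)
  refine tendsto_of_tendsto_of_tendsto_of_le_of_le' tendsto_const_nhds hlim
    (.of_forall fun m => mul_nonneg (mean_mem_Icc _ _ _).1 m.cast_nonneg) ?_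
  filter_upwards [eventually_gt_atTop 0] with m hm
  -- The optimal parameter is `h / (1 + ⟨x, y⟩)`, which is undefined at `y = -x`; the choice
  -- `h / (2 r)` also gives a negative exponent and needs no case distinction.
  have hbound := mean_le_exp_add (threshold r m) hx hy
    (s := threshold r m / (2 * r)) (div_nonneg (threshold_nonneg r m) (by positivity))
  calc mean (threshold r m) x y * m
      ≤ Real.exp (-2 * (threshold r m / (2 * r)) * threshold r m +
          (1 + inner ℝ x y) * (threshold r m / (2 * r)) ^ 2) * Real.exp (Real.log m) := by
        rw [Real.exp_log (by exact_mod_cast hm)]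
        gcongr
    _ = Real.exp (((1 + inner ℝ x y) / (2 * r) - 1) * Real.log m) := by
        rw [← Real.exp_add]
        congr 1
        have h2 : Real.log m = threshold r m ^ 2 / (2 * r) := by
          rw [threshold_sq hr]
          field_simp
        rw [h2]
        field_simp
        ring

/-- If `⟨a, x + y⟩ ≥ 2 h + 1` and `|⟨a, x - y⟩| ≤ 1`, then `a` is in `hitSet h x y`; the two
variables are independent because `x + y` and `x - y` are orthogonal. -/
theorem pdf_mul_pdf_le_mean {h : ℝ} (hh : 0 ≤ h) {x y : EuclideanSpace ℝ (Fin d)}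
    (hxy : ‖x‖ = ‖y‖) (hadd : x + y ≠ 0) (hsub : x - y ≠ 0) :
    gaussianPDFReal 0 (‖x + y‖₊ ^ 2) (2 * h + 2) * gaussianPDFReal 0 (‖x - y‖₊ ^ 2) 1 ≤
      mean h x y := by
  have hindep := indepFun_inner_stdGaussian
    ((real_inner_add_sub_eq_zero_iff x y).2 hxy)
  have hU := gaussianPDFReal_le_measureReal_Icc (‖x + y‖₊ ^ 2) (by simpa using hadd)
    (t := 2 * h + 1) (by positivity)
  have hV := gaussianPDFReal_le_measureReal_Icc (‖x - y‖₊ ^ 2) (by simpa using hsub) le_rfl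
  rw [← (hasLaw_inner_stdGaussian _).map_eq,
    map_measureReal_apply (by fun_prop) measurableSet_Icc] at hU hV
  have hprod := congrArg ENNReal.toReal (hindep.measure_inter_preimage_eq_mul
    (Set.Icc (2 * h + 1) (2 * h + 1 + 1)) (Set.Icc 0 (0 + 1)) measurableSet_Icc measurableSet_Icc)
  rw [ENNReal.toReal_mul] at hprod
  rw [show 2 * h + 1 + 1 = 2 * h + 2 by ring] at hU hprod
  rw [zero_add] at hV hprod
  rw [mean_eq_measureReal]
  refine (mul_le_mul hU hV (gaussianPDFReal_nonneg _ _ _) measureReal_nonneg).trans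
    (hprod.symm.trans_le (measureReal_mono ?_))
  rintro a ⟨⟨ha1, -⟩, ha2, ha3⟩
  simp only [inner_add_right, inner_sub_right] at ha1 ha2 ha3
  exact ⟨by linarith, by linarith⟩

theorem tendsto_mul_mean_atTop {x y : EuclideanSpace ℝ (Fin d)} (hx : ‖x‖ = 1) (hy : ‖y‖ = 1)
    (hne : x ≠ y) {r : ℝ} (hr : 0 < r) (hxy : 2 * r - 1 < inner ℝ x y) :
    Tendsto (fun m : ℕ => m * mean (threshold r m) x y) atTop atTop := by
  have hl : 0 < 1 + inner ℝ x y := by linarith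
  have hadd : x + y ≠ 0 := fun h0 => by
    have := norm_add_sq_eq hx hy
    rw [h0] at this
    simp at this
    linarith
  set K : ℝ := (√(2 * Real.pi * ‖x + y‖ ^ 2))⁻¹ * gaussianPDFReal 0 (‖x - y‖₊ ^ 2) 1 with hK
  have hKpos : 0 < K := mul_pos (inv_pos.2 (Real.sqrt_pos.2 (by positivity)))
    (gaussianPDFReal_pos _ _ _ (by simpa [sub_eq_zero] using hne))
  -- With `log m = h² / (2 r)`, the lower bound for `m * p` is `K` times the exponential of a
  -- quadratic polynomial in `h` with leading coefficient `A`.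
  set A : ℝ := 1 / (2 * r) - 1 / (1 + inner ℝ x y) with hA
  have hApos : 0 < A := sub_pos.2 (one_div_lt_one_div_of_lt (by positivity) (by linarith))
  have hquad : Tendsto (fun m : ℕ => threshold r m * (A * threshold r m - 2 / (1 + inner ℝ x y))
      - 1 / (1 + inner ℝ x y)) atTop atTop :=
    tendsto_atTop_add_const_right _ _ ((tendsto_threshold hr).atTop_mul_atTop₀
      (tendsto_atTop_add_const_right _ _ ((tendsto_threshold hr).const_mul_atTop hApos)))
  refine tendsto_atTop_mono' _ ?_ ((Real.tendsto_exp_atTop.comp hquad).const_mul_atTop hKpos)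
  filter_upwards [eventually_gt_atTop 0] with m hm
  have hbound := pdf_mul_pdf_le_mean (threshold_nonneg r m) (hx.trans hy.symm) hadd
    (sub_ne_zero.2 hne)
  have hm' : (0 : ℝ) < m := by exact_mod_cast hm
  refine le_trans (le_of_eq ?_) (mul_le_mul_of_nonneg_left hbound hm'.le)
  have h2 : Real.log m = threshold r m ^ 2 / (2 * r) := by
    rw [threshold_sq hr]
    field_simp
  have hexp : Real.exp (threshold r m * (A * threshold r m - 2 / (1 + inner ℝ x y))
      - 1 / (1 + inner ℝ x y)) =
        m * Real.exp (-(2 * threshold r m + 2) ^ 2 / (2 * ‖x + y‖ ^ 2)) := by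
    conv_rhs => rw [← Real.exp_log hm']
    rw [← Real.exp_add, h2, norm_add_sq_eq hx hy, hA]
    congr 1
    field_simp
    ring
  simp only [Function.comp_apply, hexp, hK, gaussianPDFReal, sub_zero, NNReal.coe_pow, coe_nnnorm]
  ring

theorem tendsto_mul_sigmaSq_atTop {x y : EuclideanSpace ℝ (Fin d)} (hx : ‖x‖ = 1) (hy : ‖y‖ = 1)
    (hne : x ≠ y) {r : ℝ} (hr : 0 < r) (hxy : 2 * r - 1 < inner ℝ x y) :
    Tendsto (fun m : ℕ => m * sigmaSq (threshold r m) x y) atTop atTop := by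
  have hmean : Tendsto (fun m => mean (threshold r m) x y) atTop (𝓝 0) := by
    refine squeeze_zero (fun m => (mean_mem_Icc _ _ _).1) (fun m => mean_le_exp_left _ hx y) ?_
    exact Real.tendsto_exp_atBot.comp (tendsto_atBot_add_const_right _ _
      (tendsto_neg_atTop_atBot.comp (tendsto_threshold hr)))
  have hone : Tendsto (fun m => 1 - mean (threshold r m) x y) atTop (𝓝 1) := by
    simpa using hmean.const_sub 1
  refine ((tendsto_mul_mean_atTop hx hy hne hr hxy).atTop_mul_pos one_pos hone).congr fun m => ?_
  rw [sigmaSq_eq, mul_assoc]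

/-! ### The score -/

theorem measureReal_score_ne_zero_le {Ω : Type*} [MeasurableSpace Ω] {P : Measure Ω}
    [IsProbabilityMeasure P] {m : ℕ} {a : Fin m → Ω → EuclideanSpace ℝ (Fin d)}
    (hlaw : ∀ i, HasLaw (a i) (stdGaussian (EuclideanSpace ℝ (Fin d))) P) (h : ℝ)
    (x y : EuclideanSpace ℝ (Fin d)) :
    P.real {ω | score h (fun i => a i ω) x y ≠ 0} ≤ mean h x y * m := by
  have hsub : {ω | score h (fun i => a i ω) x y ≠ 0} ⊆ ⋃ i, {ω | a i ω ∈ hitSet h x y} := by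
    intro ω hω
    by_contra hnot
    simp only [Set.mem_iUnion, Set.mem_ofPred_eq, not_exists] at hnot
    refine hω ?_
    simp [score, hit_eq_indicator, hnot]
  calc P.real {ω | score h (fun i => a i ω) x y ≠ 0}
      ≤ P.real (⋃ i, {ω | a i ω ∈ hitSet h x y}) := measureReal_mono hsub
    _ ≤ ∑ i, P.real {ω | a i ω ∈ hitSet h x y} := measureReal_iUnion_fintype_le _
    _ = mean h x y * m := by
        simp [fun i => (hlaw i).measureReal_eq (p := (· ∈ hitSet h x y))
          (measurableSet_hitSet h x y), mean_eq_measureReal, mul_comm]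

theorem tendstoInDistribution_normalizedScore {x y : EuclideanSpace ℝ (Fin d)} {h : ℕ → ℝ}
    (hvar : Tendsto (fun m : ℕ => m * sigmaSq (h m) x y) atTop atTop)
    {Ω : ℕ → Type*} [∀ m, MeasurableSpace (Ω m)]
    {P : (m : ℕ) → Measure (Ω m)} [∀ m, IsProbabilityMeasure (P m)]
    {a : (m : ℕ) → Fin m → Ω m → EuclideanSpace ℝ (Fin d)}
    (hlaw : ∀ m i, HasLaw (a m i) (stdGaussian (EuclideanSpace ℝ (Fin d))) (P m))
    (hindep : ∀ m, iIndepFun (a m) (P m)) :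
    TendstoInDistribution (fun m ω => normalizedScore (h m) (fun i => a m i ω) x y)
      atTop (id : ℝ → ℝ) P (gaussianReal 0 1) := by
  set f : ℕ → EuclideanSpace ℝ (Fin d) → ℝ := fun m z => hit (h m) x y z - mean (h m) x y with hf
  have hfm (m : ℕ) : Measurable (f m) := (measurable_hit _ x y).sub_const _
  set ν : ℕ → Measure ℝ := fun m => (stdGaussian (EuclideanSpace ℝ (Fin d))).map (f m) with hν
  have (m : ℕ) : IsProbabilityMeasure (ν m) :=
    Measure.isProbabilityMeasure_map (hfm m).aemeasurable
  have hflaw (m : ℕ) : HasLaw (f m) (ν m) (stdGaussian (EuclideanSpace ℝ (Fin d))) :=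
    ⟨(hfm m).aemeasurable, rfl⟩
  have hsq (m : ℕ) : ∫ z, z ^ 2 ∂ν m = sigmaSq (h m) x y := by
    rw [hν, integral_map (hfm m).aemeasurable (by fun_prop), sigmaSq,
      variance_eq_integral (measurable_hit _ x y).aemeasurable]
    rfl
  have hcentered (m : ℕ) : ∫ z, z ∂ν m = 0 := by
    rw [← (hflaw m).integral_eq, integral_sub _ (integrable_const _)]
    · simp [mean]
    · refine .of_bound (C := 1) (measurable_hit _ x y).aestronglyMeasurable
        (ae_of_all _ fun z => ?_)
      rw [Real.norm_of_nonneg (hit_mem_Icc _ x y z).1]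
      exact (hit_mem_Icc _ x y z).2
  have hbound (m : ℕ) : ∀ᵐ z ∂ν m, |z| ≤ 1 := by
    rw [ae_map_iff (hfm m).aemeasurable (measurableSet_le (by fun_prop) (by fun_prop))]
    refine ae_of_all _ fun z => ?_
    have h1 := hit_mem_Icc (h m) x y z
    have h2 := mean_mem_Icc (h m) x y
    rw [abs_le]
    constructor <;> simp only [hf] <;> linarith [h1.1, h1.2, h2.1, h2.2]
  have key := tendstoInDistribution_of_bounded_iid_rows
    (fun m i => (hflaw m).comp (hlaw m i))
    (fun m => (hindep m).comp (fun _ => f m) fun _ => hfm m) hbound hcentered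
    (by simpa only [hsq] using hvar)
  convert key using 3 with m ω
  -- For `m = 0` both sides vanish: one has the factor `√0`, the other an empty sum.
  rcases m.eq_zero_or_pos with rfl | hm
  · simp [normalizedScore]
  · have hm' : (0 : ℝ) < m := by exact_mod_cast hm
    have hs : √(m : ℝ) ≠ 0 := (Real.sqrt_pos.2 hm').ne'
    rw [hsq, Real.sqrt_mul hm'.le, normalizedScore, score]
    simp only [Function.comp_apply, hf, Finset.sum_sub_distrib, Finset.sum_const,
      Finset.card_univ, Fintype.card_fin, nsmul_eq_mul]
    rw [mul_inv, ← Real.sqrt_div_self]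
    field_simp

end GaussianScore

theorem lemma1 {d : ℕ} (x y : EuclideanSpace ℝ (Fin d))
    (hx : x ∈ Metric.sphere (0 : EuclideanSpace ℝ (Fin d)) 1)
    (hy : y ∈ Metric.sphere (0 : EuclideanSpace ℝ (Fin d)) 1)
    (l : ℝ) (hxy : inner ℝ x y = l) (hl : l < 1) (r : ℝ) (hr : 0 < r)
    -- for every `m`, independent standard normal vectors `a m 0, …, a m (m - 1)` in `ℝ^d`
    {Ω : ℕ → Type*} [∀ m, MeasurableSpace (Ω m)]
    (P : (m : ℕ) → Measure (Ω m)) [∀ m, IsProbabilityMeasure (P m)]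
    (a : (m : ℕ) → Fin m → Ω m → EuclideanSpace ℝ (Fin d))
    (hlaw : ∀ m i, HasLaw (a m i) (stdGaussian (EuclideanSpace ℝ (Fin d))) (P m))
    (hindep : ∀ m, iIndepFun (a m) (P m)) :
    -- `μ` and `σ²` are functions of `l` (and of the threshold) only
    (∀ (m : ℕ), ∀ x' ∈ Metric.sphere (0 : EuclideanSpace ℝ (Fin d)) 1,
      ∀ y' ∈ Metric.sphere (0 : EuclideanSpace ℝ (Fin d)) 1, inner ℝ x' y' = l →
        GaussianScore.mean (GaussianScore.threshold r m) x' y' =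
          GaussianScore.mean (GaussianScore.threshold r m) x y ∧
        GaussianScore.sigmaSq (GaussianScore.threshold r m) x' y' =
          GaussianScore.sigmaSq (GaussianScore.threshold r m) x y) ∧
    -- Case 1
    (l < 2 * r - 1 →
      (∀ m : ℕ,
        (P m).real {ω | GaussianScore.score (GaussianScore.threshold r m)
          (fun i => a m i ω) x y ≠ 0} ≤
            GaussianScore.mean (GaussianScore.threshold r m) x y * m) ∧
      Tendsto (fun m : ℕ => GaussianScore.mean (GaussianScore.threshold r m) x y * m)
        atTop (𝓝 0)) ∧
    -- Case 2
    (2 * r - 1 < l →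
      TendstoInDistribution
        (fun (m : ℕ) (ω : Ω m) => GaussianScore.normalizedScore (GaussianScore.threshold r m)
          (fun i => a m i ω) x y)
        atTop (id : ℝ → ℝ) P (gaussianReal 0 1)) := by

  have hx1 : ‖x‖ = 1 := mem_sphere_zero_iff_norm.1 hx
  have hy1 : ‖y‖ = 1 := mem_sphere_zero_iff_norm.1 hy
  have hne : x ≠ y := by
    rintro rfl
    rw [real_inner_self_eq_norm_sq, hx1] at hxy
    linarith
  subst hxy
  refine ⟨fun m x' hx' y' hy' hxy' => ?_, fun hlt => ⟨fun m => ?_, ?_⟩, fun hlt => ?_⟩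
  · have hmean := GaussianScore.mean_eq_of_inner_eq (h := GaussianScore.threshold r m)
      ((mem_sphere_zero_iff_norm.1 hx').trans hx1.symm)
      ((mem_sphere_zero_iff_norm.1 hy').trans hy1.symm) hxy'
    exact ⟨hmean, by rw [GaussianScore.sigmaSq_eq, GaussianScore.sigmaSq_eq, hmean]⟩
  · exact GaussianScore.measureReal_score_ne_zero_le (hlaw m) _ x y
  · exact GaussianScore.tendsto_mean_mul_nhds_zero hx1 hy1 hr hlt
  · exact GaussianScore.tendstoInDistribution_normalizedScore
      (GaussianScore.tendsto_mul_sigmaSq_atTop hx1 hy1 hne hr hlt) hlaw hindep
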